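/- **Setting.** Let $\mathcal I$ be a countable set, $\Omega=[q_-,q_+]^{\mathcal I}$ with the product Borel $\sigma$-algebra $\mathfrak F$, $\mathbb P$ a probability measure on $(\Omega,\mathfrak F)$, and $\mathcal I_F\subseteq\mathcal I$ a finite set. Let $\mathfrak F_{\mathbb P}$ be the $\mathbb P$-completion of $\mathfrak F$ and $\overline{\mathbb E}$ the extension of the expectation to it. For $\alpha\in\mathcal I$ write $\hat\omega_\alpha=(\omega_\beta)_{\beta\ne\alpha}$, let $\mu_{\hat\omega_\alpha}$ be the regular conditional distribution of $\omega_\alpha$ given $\hat\omega_\alpha$, and put $$s_F(\mathbb P,\varepsilon)=\max_{\alpha\in\mathcal I_F}\ \mathbb E\Big[\sup_{E\in\mathbb R}\mu_{\hat\omega_\alpha}\big((E,E+\varepsilon)\big)\Big]$$ (equal to $0$ if $\mathcal I_F=\emptyset$). Let $\mathcal H$ be a separable Hilbert space, let $I=(E_1,E_2)$ with $-\infty<E_1<E_2<0$, and put $|I|=E_2-E_1$. Assume: 1. $s_F(\mathbb P,\varepsilon)\to0$ as $\varepsilon\downarrow0$. 2. For every $\omega\in\Omega$, $H(\omega)$ is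 a self-adjoint operator on $\mathcal H$, bounded from below, with an orthonormal basis of eigenvectors and eigenvalues $\lambda_1(\omega)\le\lambda_2(\omega)\le\cdots$, repeated according to multiplicity. 3. There is a number $K\ge0$ independent of $\omega$ such that $\lambda_n(\omega)\notin I$ for all $n>K$ and all $\omega$. 4. Either the operator domain $\mathcal D=D(H(\omega))$ does not depend on $\omega$, and then $f_u(\omega):=\langle H(\omega)u,u\rangle$ for $u\in\mathcal D$; or the form domain $\mathcal D=D(\mathfrak h^\omega)$ does not depend on $\omega$, and then $f_u(\omega):=\mathfrak h^\omega[u]$ for $u\in\mathcal D$, where $\mathfrak h^\omega$ is the closed quadratic form associated with $H(\omega)$. 5. There are $q>q_+$ and a real $\zeta\ne0$ such that for every $u\in\mathcal D$ there are constants $a(u)\ge0$ and $b_\alpha(u)\ge0$ ($\alpha\in\mathcal I_F$), independent of $\omega$, with $$f_u(\omega)=a(u)-\sum_{\alpha\in\mathcal I_F}(q-\omega_\alpha)^{\zeta}\,b_\alpha(u)\qquad\text{for all }\omega\in\Omega.$$ **Theorem.** Let $\chi_I(H(\omega))$ be the spectral projection of $H(\omega)$ onto $I$. Then $\omega\mapsto\operatorname{tr}[\chi_I(H(\omega))]$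 is $\mathfrak F_{\mathbb P}$-measurable and $$\overline{\mathbb E}\{\operatorname{tr}[\chi_I(H(\omega))]\}\le 2K\,|\mathcal I_F|\; s_F\!\left(\mathbb P,\ (q-q_-)\Big(\Big(1+\frac{|I|}{|E_2|}\Big)^{1/|\zeta|}-1\Big)\right).$$ In particular, if $\zeta=\pm1$, then $$\overline{\mathbb E}\{\operatorname{tr}[\chi_I(H(\omega))]\}\le 2K\,|\mathcal I_F|\; s_F\!\left(\mathbb P,\ \frac{q-q_-}{|E_2|}\,|I|\right).$$ -/

import Mathlib

open MeasureTheory ProbabilityTheory Filter Topology Set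
open scoped ENNReal

noncomputable section Wegner

/-- The conditional law of the real coordinate `ω α` given the remaining coordinates
`(ω β)_{β ≠ α}`, for a probability measure `P` on the product space `ι → B`
with the product Borel σ-algebra. It is a regular conditional distribution,
regarded as a measure on `ℝ`. -/
def coordCondLaw {ι : Type*} {B : Set ℝ} (P : Measure (ι → B)) [IsProbabilityMeasure P]
    (α : ι) : Kernel ({β : ι // β ≠ α} → B) ℝ :=
  condDistrib (fun ω : ι → B => (ω α : ℝ)) (fun ω (β : {β : ι // β ≠ α}) => ω β) P

/-- The modulus of continuity
`s_F(P, ε) = max_{α ∈ F} 𝔼 [ sup_{E ∈ ℝ} μ_{ω̂_α} (E, E + ε) ]`, where `μ_{ω̂_α}` is the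
conditional law of `ω_α` given the other coordinates, and the expectation is over the law
of the other coordinates (it is `0` if `F` is empty). -/
def modulusF {ι : Type*} {B : Set ℝ} (P : Measure (ι → B)) [IsProbabilityMeasure P]
    (F : Finset ι) (ε : ℝ) : ℝ≥0∞ :=
  ⨆ α ∈ F, ∫⁻ y, (⨆ E : ℝ, coordCondLaw P α y (Ioo E (E + ε)))
    ∂(P.map (fun ω (β : {β : ι // β ≠ α}) => ω β))

section Operators

variable {𝕜 E : Type*} [RCLike 𝕜] [NormedAddCommGroup E] [InnerProductSpace 𝕜 E]

/-- The quadratic form `⟨T u, u⟩` on the domain of `T` (a real number for symmetric `T`). -/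
def opForm (T : E →ₗ.[𝕜] E) (u : T.domain) : ℝ :=
  RCLike.re (inner 𝕜 (T u) (u : E))

/-- `T` is bounded from below. -/
def BoundedBelow (T : E →ₗ.[𝕜] E) : Prop :=
  ∃ c : ℝ, ∀ u : T.domain, c * ‖(u : E)‖ ^ 2 ≤ opForm T u

/-- A sequence in the domain of `T` that converges to `u` and is Cauchy for the quadratic
form of `T`. -/
def FormConverges (T : E →ₗ.[𝕜] E) (x : ℕ → T.domain) (u : E) : Prop :=
  Tendsto (fun n => (x n : E)) atTop (𝓝 u) ∧
    Tendsto (fun p : ℕ × ℕ => opForm T (x p.1 - x p.2)) atTop (𝓝 0)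

/-- The domain of the closed form `𝔥` associated with a self-adjoint operator `T` that is
bounded from below: `𝔥` is the closure of the form `u ↦ ⟨T u, u⟩` on the domain of `T`. -/
def formDomain (T : E →ₗ.[𝕜] E) : Set E :=
  {u | ∃ x : ℕ → T.domain, FormConverges T x u}

/-- `u` lies in the domain of the closed form `𝔥` associated with `T`, and `𝔥[u] = r`, that is,
`r` is the limit of `⟨T xₙ, xₙ⟩` for a sequence `xₙ` that converges to `u` in the form sense.
(The limit exists, and does not depend on the sequence, when `T` is symmetric and bounded
from below.) -/
def HasFormValue (T : E →ₗ.[𝕜] E) (u : E) (r : ℝ) : Prop :=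
  ∃ x : ℕ → T.domain, FormConverges T x u ∧
    Tendsto (fun n => opForm T (x n)) atTop (𝓝 r)

/-- `lam 0 ≤ lam 1 ≤ …` (`N` of them, `N ≤ ∞`) are the eigenvalues of `T`, repeated according to
multiplicity: there is an orthonormal (Hilbert) basis of eigenvectors `φ 0, φ 1, …`
with `T (φ n) = lam n • φ n`. -/
def IsEigenvalueSequence (T : E →ₗ.[𝕜] E) {N : ℕ∞} (lam : {n : ℕ // (n : ℕ∞) < N} → ℝ) : Prop :=
  Monotone lam ∧ ∃ φ : HilbertBasis {n : ℕ // (n : ℕ∞) < N} 𝕜 E,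
    ∀ n, ∃ h : φ n ∈ T.domain, T ⟨φ n, h⟩ = (lam n : 𝕜) • φ n

/-- The family `H ω` has a common operator domain `D` and `f u ω = ⟨H ω u, u⟩`, or it has
a common form domain `D` and `f u ω = 𝔥_ω[u]`, where `𝔥_ω` is the form associated with `H ω`. -/
def HasCommonDomain {Ω : Type*} (H : Ω → E →ₗ.[𝕜] E) (D : Set E) (f : E → Ω → ℝ) : Prop :=
  (∀ ω, ((H ω).domain : Set E) = D ∧ ∀ u : (H ω).domain, f u ω = opForm (H ω) u) ∨
  (∀ ω, formDomain (H ω) = D ∧ ∀ u ∈ D, HasFormValue (H ω) u (f u ω))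

variable [CompleteSpace E]

/-- The spectral projection `χ_S(T)` of a self-adjoint operator `T` that has an orthonormal basis
of eigenvectors: the orthogonal projection onto the closed span of the eigenvectors of `T`
with eigenvalue in `S`. -/
def spectralProj (T : E →ₗ.[𝕜] E) (S : Set ℝ) : E →L[𝕜] E :=
  (Submodule.span 𝕜 {u : E | ∃ μ ∈ S, ∃ h : u ∈ T.domain,
    T ⟨u, h⟩ = (μ : 𝕜) • u}).topologicalClosure.starProjection

/-- The trace of a positive bounded operator, `∑ ⟨A e, e⟩ ∈ [0, ∞]`, over an orthonormal basis
(the value does not depend on the basis). -/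
def posTrace (A : E →L[𝕜] E) : ℝ≥0∞ :=
  ∑' e : (exists_hilbertBasis 𝕜 E).choose, ENNReal.ofReal (RCLike.re (inner 𝕜 (A e) (e : E)))

end Operators

end Wegner

/-! By the min-max principle, the eigenvalue with index `n` lies below `M` exactly when the form `a
- ∑ (q - ω α) ^ ζ * b α` is smaller than `M ‖u‖²` on some subspace of dimension `n + 1`
(`eigenvalue_lt_iff`). The form is monotone in each coordinate, so after a sign change `σ` these
configurations form a lower set `W M`.

Since `E₂ < 0`, multiplying by `s = E₁ / E₂ > 1` turns the bound `E₂` into `E₁`. As `a ≥ 0`, only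
the weights need scaling, and `s (q - ω α) ^ ζ` is again such a weight at a displaced coordinate
(`scaledPoint_sub_mem_smallWeightSet`). Hence an eigenvalue in `(E₁, E₂)` forces `ω` to lie outside
`W E₁` but to enter it after all coordinates in `F` are shifted down by a fixed `η`.

Shifting one coordinate at a time, each step concerns sets whose fibres have diameter at most `η`;
conditioning bounds it by `2 * modulusF P F η` (`measure_shift_le`). Summing over `F` and over at
most `K` eigenvalues gives the estimate. Measurability holds because a lower set differs from an
open one by a null event once the modulus tends to `0`. -/

/-- A set of real numbers of diameter at most `η` is covered by two open intervals of
length `η`. -/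
theorem measure_le_two_mul_iSup_Ioo (μ : Measure ℝ) {B : Set ℝ} {η : ℝ} (hη : 0 < η)
    (hB : ∀ x ∈ B, ∀ y ∈ B, x - y ≤ η) :
    μ B ≤ 2 * ⨆ E : ℝ, μ (Ioo E (E + η)) := by
  rcases B.eq_empty_or_nonempty with rfl | ⟨x₀, hx₀⟩
  · simp
  have hbd : BddBelow B := ⟨x₀ - η, fun y hy => by linarith [hB x₀ hx₀ y hy]⟩
  -- `B` lies in a closed interval of length `η`, which one open interval of that length may miss at
  -- an end; the margins `η / 4` on either side repair this.
  have hsub : B ⊆ Ioo (sInf B - η / 4) (sInf B - η / 4 + η) ∪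
      Ioo (sInf B + η / 4) (sInf B + η / 4 + η) := by
    intro x hx
    have h1 : sInf B ≤ x := csInf_le hbd hx
    have h2 : x - η ≤ sInf B := le_csInf ⟨x₀, hx₀⟩ fun y hy => by linarith [hB x hx y hy]
    by_cases h : x < sInf B + η / 2
    · left; constructor <;> linarith
    · right; constructor <;> linarith
  calc μ B ≤ μ _ := measure_mono hsub
    _ ≤ _ := measure_union_le _ _
    _ ≤ _ := by
      rw [two_mul]
      exact add_le_add (le_iSup (fun E : ℝ => μ (Ioo E (E + η))) _)
        (le_iSup (fun E : ℝ => μ (Ioo E (E + η))) _)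

/-! ### Lower sets in finitely many coordinates -/

/-- `W` is a lower set with respect to the coordinates in `F`. -/
def IsLowerOn {ι : Type*} (F : Finset ι) (W : Set (ι → ℝ)) : Prop :=
  ∀ x ∈ W, ∀ y : ι → ℝ, (∀ α ∈ F, y α ≤ x α) → y ∈ W

/-- The vector with entries `η` at the coordinates in `T`, and `0` elsewhere. -/
noncomputable def constOn {ι : Type*} (T : Finset ι) (η : ℝ) : ι → ℝ :=
  (T : Set ι).indicator fun _ => η

theorem constOn_apply_of_mem {ι : Type*} {T : Finset ι} {α : ι} (h : α ∈ T) (η : ℝ) :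
    constOn T η α = η :=
  indicator_of_mem (Finset.mem_coe.2 h) _

theorem constOn_apply_of_notMem {ι : Type*} {T : Finset ι} {α : ι} (h : α ∉ T) (η : ℝ) :
    constOn T η α = 0 :=
  indicator_of_notMem (fun h' => h (Finset.mem_coe.1 h')) _

/-- The points that lie strictly below some point of `W` in all coordinates in `F`. -/
def strictLower {ι : Type*} (F : Finset ι) (W : Set (ι → ℝ)) : Set (ι → ℝ) :=
  {x | ∃ y ∈ W, ∀ α ∈ F, x α < y α}

theorem isLowerOn_strictLower {ι : Type*} (F : Finset ι) (W : Set (ι → ℝ)) :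
    IsLowerOn F (strictLower F W) := by
  rintro x ⟨y, hy, hxy⟩ z hz
  exact ⟨y, hy, fun α hα => (hz α hα).trans_lt (hxy α hα)⟩

theorem isOpen_strictLower {ι : Type*} (F : Finset ι) (W : Set (ι → ℝ)) :
    IsOpen (strictLower F W) := by
  have : strictLower F W = ⋃ y ∈ W, ⋂ α ∈ F, {x : ι → ℝ | x α < y α} := by
    ext x; simp [strictLower]
  rw [this]
  exact isOpen_biUnion fun y _ => isOpen_biInter_finset fun α _ =>
    isOpen_lt (continuous_apply α) continuous_const

theorem IsLowerOn.strictLower_subset {ι : Type*} {F : Finset ι} {W : Set (ι → ℝ)}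
    (hW : IsLowerOn F W) : strictLower F W ⊆ W := by
  rintro x ⟨y, hy, hxy⟩
  exact hW y hy x fun α hα => (hxy α hα).le

theorem sub_constOn_mem_strictLower {ι : Type*} {F : Finset ι} {W : Set (ι → ℝ)} {x : ι → ℝ}
    (hx : x ∈ W) {δ : ℝ} (hδ : 0 < δ) : x - constOn F δ ∈ strictLower F W :=
  ⟨x, hx, fun α hα => by rw [Pi.sub_apply, constOn_apply_of_mem hα]; linarith⟩

/-! ### Probability that a shift enters a lower set -/

section Product

variable {ι : Type*} {qm qp : ℝ}

/-- The point `ω`, with all coordinates multiplied by `σ`. -/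
def scaledPoint (σ : ℝ) (ω : ι → Icc qm qp) : ι → ℝ := fun α => σ * (ω α : ℝ)

theorem measurable_scaledPoint (σ : ℝ) :
    Measurable (scaledPoint σ : (ι → Icc qm qp) → ι → ℝ) :=
  measurable_pi_lambda _ fun α =>
    ((measurable_subtype_coe.comp (measurable_pi_apply α)).const_mul σ)

variable [Countable ι] (P : Measure (ι → Icc qm qp)) [IsProbabilityMeasure P]

/-- Disintegration along the coordinate `α`: a measurable set whose sections in direction `α` have
diameter at most `η` has small probability. -/
theorem measure_le_of_sections {F : Finset ι} {α : ι} (hα : α ∈ F) {η : ℝ} (hη : 0 < η)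
    {B : Set (({β : ι // β ≠ α} → Icc qm qp) × ℝ)} (hB : MeasurableSet B)
    (hdiam : ∀ y s t, (y, s) ∈ B → (y, t) ∈ B → s - t ≤ η) :
    P {ω | ((fun β : {β : ι // β ≠ α} => ω β), (ω α : ℝ)) ∈ B} ≤ 2 * modulusF P F η := by
  have hX : Measurable (fun (ω : ι → Icc qm qp) (β : {β : ι // β ≠ α}) => ω β) :=
    measurable_pi_lambda _ fun β => measurable_pi_apply _
  have hY : Measurable (fun ω : ι → Icc qm qp => (ω α : ℝ)) :=
    measurable_subtype_coe.comp (measurable_pi_apply α)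
  calc P {ω | ((fun β : {β : ι // β ≠ α} => ω β), (ω α : ℝ)) ∈ B}
      = P.map (fun ω : ι → Icc qm qp =>
          ((fun β : {β : ι // β ≠ α} => ω β), (ω α : ℝ))) B :=
        (Measure.map_apply (hX.prodMk hY) hB).symm
    _ = ((P.map fun ω (β : {β : ι // β ≠ α}) => ω β) ⊗ₘ coordCondLaw P α) B := by
        rw [coordCondLaw, compProd_map_condDistrib hY.aemeasurable]
    _ = ∫⁻ y, coordCondLaw P α y (Prod.mk y ⁻¹' B)
          ∂(P.map fun ω (β : {β : ι // β ≠ α}) => ω β) := by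
        have : IsMarkovKernel (coordCondLaw P α) := by unfold coordCondLaw; infer_instance
        exact Measure.compProd_apply hB
    _ ≤ ∫⁻ y, 2 * (⨆ E : ℝ, coordCondLaw P α y (Ioo E (E + η)))
          ∂(P.map fun ω (β : {β : ι // β ≠ α}) => ω β) :=
        lintegral_mono fun y => measure_le_two_mul_iSup_Ioo _ hη
          fun s hs t ht => hdiam y s t hs ht
    _ = 2 * ∫⁻ y, (⨆ E : ℝ, coordCondLaw P α y (Ioo E (E + η)))
          ∂(P.map fun ω (β : {β : ι // β ≠ α}) => ω β) :=
        -- Finiteness of the constant suffices here, so measurability of the uncountable supremum is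
        -- not needed.
        lintegral_const_mul' _ _ (by simp)
    _ ≤ 2 * modulusF P F η := by
        gcongr
        exact le_iSup₂ (f := fun α (_ : α ∈ F) =>
          ∫⁻ y, (⨆ E : ℝ, coordCondLaw P α y (Ioo E (E + η)))
            ∂(P.map fun ω (β : {β : ι // β ≠ α}) => ω β)) α hα

/-- On a line in direction `α` the lower set cuts out a half-line, and the event keeps only points
between its end and that end moved by `η`. -/
theorem measure_single_coordinate_shift_le [DecidableEq ι] {σ : ℝ} (hσ : σ = 1 ∨ σ = -1)
    {F : Finset ι} {G : Set (ι → ℝ)}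
    (hG : IsLowerOn F G) (hGm : MeasurableSet G) {α : ι} (hα : α ∈ F) {T : Finset ι} (hαT : α ∉ T)
    {η : ℝ} (hη : 0 < η) :
    P {ω | scaledPoint σ ω - constOn T η ∉ G ∧ scaledPoint σ ω - constOn (insert α T) η ∈ G}
      ≤ 2 * modulusF P F η := by
  -- `z` rebuilds the shifted point from the other coordinates and a real value at `α`, so that the
  -- event becomes a set in the disintegrated space.
  let z (U : Finset ι) (p : ({β : ι // β ≠ α} → Icc qm qp) × ℝ) : ι → ℝ := fun β =>
    (if h : β ≠ α then σ * (p.1 ⟨β, h⟩ : ℝ) else σ * p.2) - constOn U η β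
  have hz (U : Finset ι) : Measurable (z U) := by
    refine measurable_pi_lambda _ fun β => ?_
    refine Measurable.sub_const ?_ _
    by_cases h : β ≠ α
    · simp only [h, dite_true, ne_eq, not_false_eq_true]
      exact (measurable_subtype_coe.comp
        ((measurable_pi_apply _).comp measurable_fst)).const_mul σ
    · simp only [h, dite_false]
      exact measurable_snd.const_mul σ
  have hzω (U : Finset ι) (ω : ι → Icc qm qp) :
      z U ((fun β : {β : ι // β ≠ α} => ω β), (ω α : ℝ)) = scaledPoint σ ω - constOn U η := by
    funext β
    by_cases h : β = α
    · subst h; simp [z, scaledPoint]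
    · simp [z, scaledPoint, h]
  have key := measure_le_of_sections P hα hη
    (B := {p | z T p ∉ G ∧ z (insert α T) p ∈ G})
    (((hz T) hGm).compl.inter ((hz _) hGm)) ?_
  · simpa only [mem_ofPred_eq, hzω] using key
  · rintro y s t ⟨hs1, hs2⟩ ⟨ht1, ht2⟩
    have main : ∀ s t : ℝ, z T (y, t) ∉ G → z (insert α T) (y, s) ∈ G →
        σ * s - σ * t ≤ η := by
      intro s t h1 h2
      by_contra! hlt
      refine h1 (hG _ h2 _ fun β _ => ?_)
      by_cases h : β = α
      · subst h
        simp only [z, ne_eq, not_true_eq_false, dite_false, constOn_apply_of_notMem hαT,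
          constOn_apply_of_mem (Finset.mem_insert_self _ T)]
        linarith
      · have : constOn (insert α T) η β = constOn T η β := by
          by_cases hβ : β ∈ T
          · rw [constOn_apply_of_mem hβ, constOn_apply_of_mem (Finset.mem_insert_of_mem hβ)]
          · rw [constOn_apply_of_notMem hβ, constOn_apply_of_notMem (by simp [h, hβ])]
        simp [z, h, this]
    rcases hσ with rfl | rfl
    · linarith [main s t ht1 hs2]
    · linarith [main t s hs1 ht2]

/-- Telescoping: a point that ends up in `G` after all shifts crosses into it at the shift of some
single coordinate. -/
theorem measure_shift_le_of_measurableSet {σ : ℝ} (hσ : σ = 1 ∨ σ = -1)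
    {F : Finset ι} {G : Set (ι → ℝ)} (hG : IsLowerOn F G)
    (hGm : MeasurableSet G) {η : ℝ} (hη : 0 < η) :
    P {ω | scaledPoint σ ω ∉ G ∧ scaledPoint σ ω - constOn F η ∈ G}
      ≤ 2 * F.card * modulusF P F η := by
  classical
  suffices H : ∀ T ⊆ F, P {ω | scaledPoint σ ω ∉ G ∧ scaledPoint σ ω - constOn T η ∈ G}
      ≤ 2 * T.card * modulusF P F η from H F subset_rfl
  intro T
  induction T using Finset.induction_on with
  | empty =>
    intro _
    have : constOn (∅ : Finset ι) η = 0 := by funext; simp [constOn]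
    simp [this]
  | insert α T hαT ih =>
    intro hsub
    have h1 := ih ((Finset.subset_insert _ _).trans hsub)
    have h2 := measure_single_coordinate_shift_le P hσ hG hGm (hsub (Finset.mem_insert_self α T))
      hαT hη
    calc P {ω | scaledPoint σ ω ∉ G ∧ scaledPoint σ ω - constOn (insert α T) η ∈ G}
        ≤ P ({ω | scaledPoint σ ω ∉ G ∧ scaledPoint σ ω - constOn T η ∈ G} ∪
          {ω | scaledPoint σ ω - constOn T η ∉ G ∧
            scaledPoint σ ω - constOn (insert α T) η ∈ G}) := by
          refine measure_mono fun ω hω => ?_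
          by_cases h : scaledPoint σ ω - constOn T η ∈ G
          · exact Or.inl ⟨hω.1, h⟩
          · exact Or.inr ⟨h, hω.2⟩
      _ ≤ _ := measure_union_le _ _
      _ ≤ 2 * T.card * modulusF P F η + 2 * modulusF P F η := add_le_add h1 h2
      _ = _ := by
        rw [Finset.card_insert_of_notMem hαT]
        push_cast
        ring

/-- Every positive shift moves a point of `W` into the open set `strictLower F W`, so the shift
bound applies for all `η > 0`, and its right side tends to `0`. -/
theorem measure_boundary_eq_zero {σ : ℝ} (hσ : σ = 1 ∨ σ = -1) {F : Finset ι}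
    (hP : Tendsto (fun ε : ℝ => modulusF P F ε) (𝓝[>] 0) (𝓝 0))
    {W : Set (ι → ℝ)} :
    P {ω | scaledPoint σ ω ∈ W ∧ scaledPoint σ ω ∉ strictLower F W} = 0 := by
  have hlim : Tendsto (fun ε : ℝ => 2 * (F.card : ℝ≥0∞) * modulusF P F ε) (𝓝[>] 0) (𝓝 0) := by
    simpa using ENNReal.Tendsto.const_mul (a := 2 * (F.card : ℝ≥0∞)) hP
      (Or.inr (ENNReal.mul_ne_top (by simp) (by simp)))
  refine le_antisymm (ge_of_tendsto hlim ?_) zero_le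
  filter_upwards [self_mem_nhdsWithin] with η hη
  refine le_trans (measure_mono fun ω hω => ?_) (measure_shift_le_of_measurableSet P hσ
    (isLowerOn_strictLower F W) (isOpen_strictLower F W).measurableSet hη)
  exact ⟨hω.2, sub_constOn_mem_strictLower hω.1 hη⟩

theorem nullMeasurableSet_of_isLowerOn {σ : ℝ} (hσ : σ = 1 ∨ σ = -1) {F : Finset ι}
    (hP : Tendsto (fun ε : ℝ => modulusF P F ε) (𝓝[>] 0) (𝓝 0))
    {W : Set (ι → ℝ)} (hW : IsLowerOn F W) :
    NullMeasurableSet {ω | scaledPoint σ ω ∈ W} P := by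
  have hm : MeasurableSet {ω : ι → Icc qm qp | scaledPoint σ ω ∈ strictLower F W} :=
    measurable_scaledPoint σ (isOpen_strictLower F W).measurableSet
  refine hm.nullMeasurableSet.congr ?_
  refine ae_eq_set.2 ⟨?_, measure_boundary_eq_zero P hσ hP⟩
  exact measure_mono_null (fun ω hω => hω.2 (hW.strictLower_subset hω.1)) measure_empty

/-- For a set `W` that is a lower set in the coordinates in `F`, shifting these coordinates by `η`
enters `W` with small probability only. -/
theorem measure_shift_le {σ : ℝ} (hσ : σ = 1 ∨ σ = -1) {F : Finset ι}
    (hP : Tendsto (fun ε : ℝ => modulusF P F ε) (𝓝[>] 0) (𝓝 0))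
    {W : Set (ι → ℝ)} (hW : IsLowerOn F W) {η : ℝ}
    (hη : F.Nonempty → 0 < η) :
    P {ω | scaledPoint σ ω ∉ W ∧ scaledPoint σ ω - constOn F η ∈ W}
      ≤ 2 * F.card * modulusF P F η := by
  rcases F.eq_empty_or_nonempty with rfl | hF
  -- With no coordinates in `F`, a lower set is everything or empty, so the event is void whatever
  -- the sign of `η`.
  · refine le_of_eq_of_le ?_ zero_le
    convert measure_empty (μ := P)
    refine eq_empty_of_forall_notMem fun ω hω => hω.1 (hW _ hω.2 _ (by simp))
  -- Discarding the boundary of the shifted set, a null event, replaces `W` by the open set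
  -- `strictLower F W`.
  have h0 := measure_boundary_eq_zero P hσ hP (W := {x | x - constOn F η ∈ W})
  calc P {ω | scaledPoint σ ω ∉ W ∧ scaledPoint σ ω - constOn F η ∈ W}
      ≤ P ({ω | scaledPoint σ ω ∈ {x | x - constOn F η ∈ W} ∧
            scaledPoint σ ω ∉ strictLower F {x | x - constOn F η ∈ W}} ∪
          {ω | scaledPoint σ ω ∉ strictLower F W ∧
            scaledPoint σ ω - constOn F η ∈ strictLower F W}) := by
        refine measure_mono fun ω hω => ?_
        by_cases h : scaledPoint σ ω ∈ strictLower F {x | x - constOn F η ∈ W}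
        · right
          obtain ⟨y, hy, hlt⟩ := h
          exact ⟨fun h' => hω.1 (hW.strictLower_subset h'), y - constOn F η, hy,
            fun α hα => sub_lt_sub_right (hlt α hα) _⟩
        · exact Or.inl ⟨hω.2, h⟩
    _ ≤ _ := measure_union_le _ _
    _ ≤ 0 + 2 * F.card * modulusF P F η := by
        refine add_le_add h0.le ?_
        exact measure_shift_le_of_measurableSet P hσ (isLowerOn_strictLower F W)
          (isOpen_strictLower F W).measurableSet (hη hF)
    _ = _ := zero_add _

end Product

/-! ### Parseval's identity -/

section HilbertBasis

variable {𝕜 E ι : Type*} [RCLike 𝕜] [NormedAddCommGroup E] [InnerProductSpace 𝕜 E]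

/-- Parseval's identity. -/
theorem HilbertBasis.hasSum_norm_inner_sq (φ : HilbertBasis ι 𝕜 E) (x : E) :
    HasSum (fun i => ‖(inner 𝕜 (φ i) x : 𝕜)‖ ^ 2) (‖x‖ ^ 2) := by
  have h := (φ.hasSum_inner_mul_inner x x).mapL (RCLike.reCLM : 𝕜 →L[ℝ] ℝ)
  rw [RCLike.reCLM_apply, inner_self_eq_norm_sq] at h
  refine h.congr_fun fun i => ?_
  rw [← inner_conj_symm x, RCLike.conj_mul]
  norm_cast

theorem HilbertBasis.tsum_ofReal_norm_inner_sq (φ : HilbertBasis ι 𝕜 E) (x : E) :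
    ∑' i, ENNReal.ofReal (‖(inner 𝕜 (φ i) x : 𝕜)‖ ^ 2) = ENNReal.ofReal (‖x‖ ^ 2) := by
  rw [← ENNReal.ofReal_tsum_of_nonneg (fun _ => by positivity)
    (φ.hasSum_norm_inner_sq x).summable, (φ.hasSum_norm_inner_sq x).tsum_eq]

end HilbertBasis

/-! ### Forms in an eigenbasis, min-max and traces -/

section Eigenbasis

variable {𝕜 E ι : Type*} [RCLike 𝕜] [NormedAddCommGroup E] [InnerProductSpace 𝕜 E]

theorem LinearPMap.isFormalAdjoint_self [CompleteSpace E] {T : E →ₗ.[𝕜] E}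
    (hT : IsSelfAdjoint T) : T.IsFormalAdjoint T := by
  have h := LinearPMap.adjoint_isFormalAdjoint hT.dense_domain
  rwa [LinearPMap.isSelfAdjoint_def.1 hT] at h

theorem inner_eigenvector_apply {T : E →ₗ.[𝕜] E} (hT : T.IsFormalAdjoint T) {v : E} {μ : ℝ}
    (hv : ∃ h : v ∈ T.domain, T ⟨v, h⟩ = (μ : 𝕜) • v) (x : T.domain) :
    inner 𝕜 v (T x) = (μ : 𝕜) * inner 𝕜 v (x : E) := by
  obtain ⟨h, hTv⟩ := hv
  rw [← hT ⟨v, h⟩ x, hTv, inner_smul_left, RCLike.conj_ofReal]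

theorem hasSum_opForm {T : E →ₗ.[𝕜] E} (hT : T.IsFormalAdjoint T) {lam : ι → ℝ}
    {φ : HilbertBasis ι 𝕜 E}
    (hφ : ∀ k, ∃ h : φ k ∈ T.domain, T ⟨φ k, h⟩ = (lam k : 𝕜) • φ k) (x : T.domain) :
    HasSum (fun k => lam k * ‖(inner 𝕜 (φ k) (x : E) : 𝕜)‖ ^ 2) (opForm T x) := by
  have h := (φ.hasSum_inner_mul_inner (T x) x).mapL (RCLike.reCLM : 𝕜 →L[ℝ] ℝ)
  refine h.congr_fun fun k => ?_
  rw [RCLike.reCLM_apply, ← inner_conj_symm (T x), inner_eigenvector_apply hT (hφ k),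
    map_mul (starRingEnd 𝕜), RCLike.conj_ofReal, mul_assoc, RCLike.conj_mul]
  norm_cast

theorem opForm_eigenvector {T : E →ₗ.[𝕜] E} {v : E} {μ : ℝ} (h : v ∈ T.domain)
    (hv : T ⟨v, h⟩ = (μ : 𝕜) • v) : opForm T ⟨v, h⟩ = μ * ‖v‖ ^ 2 := by
  rw [opForm, hv, inner_smul_left, RCLike.conj_ofReal, RCLike.re_ofReal_mul,
    inner_self_eq_norm_sq]

/-- In terms of an orthonormal basis of eigenvectors, the form of `T` is diagonal. -/
theorem HasFormValue.hasSum {T : E →ₗ.[𝕜] E} (hT : T.IsFormalAdjoint T) (hbdd : BoundedBelow T)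
    {lam : ι → ℝ} {φ : HilbertBasis ι 𝕜 E}
    (hφ : ∀ k, ∃ h : φ k ∈ T.domain, T ⟨φ k, h⟩ = (lam k : 𝕜) • φ k) {u : E} {r : ℝ}
    (hu : HasFormValue T u r) :
    HasSum (fun k => lam k * ‖(inner 𝕜 (φ k) u : 𝕜)‖ ^ 2) r := by
  obtain ⟨c, hc⟩ := hbdd
  have hlam : ∀ k, 0 ≤ lam k - c := by
    intro k
    obtain ⟨h, hk⟩ := hφ k
    have := hc ⟨φ k, h⟩
    rw [opForm_eigenvector h hk] at this
    simpa [φ.orthonormal.norm_eq_one k] using this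
  obtain ⟨x, ⟨hxu, hxC⟩, hxr⟩ := hu
  -- the weighted coordinates
  let w (v : E) (k : ι) : 𝕜 := (√(lam k - c) : 𝕜) * inner 𝕜 (φ k) v
  have hw (v : E) (k : ι) :
      ‖w v k‖ ^ 2 = lam k * ‖(inner 𝕜 (φ k) v : 𝕜)‖ ^ 2
        - c * ‖(inner 𝕜 (φ k) v : 𝕜)‖ ^ 2 := by
    simp only [w, norm_mul, mul_pow, RCLike.norm_ofReal, sq_abs, Real.sq_sqrt (hlam k)]
    ring
  have hsum (v : T.domain) :
      HasSum (fun k => ‖w v k‖ ^ 2) (opForm T v - c * ‖(v : E)‖ ^ 2) := by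
    simp only [hw]
    exact (hasSum_opForm hT hφ v).sub ((φ.hasSum_norm_inner_sq (v : E)).mul_left c)
  have hmem (v : T.domain) : Memℓp (w v) 2 := by
    refine memℓp_gen ?_
    simpa using (hsum v).summable
  -- `J` is isometric for the form shifted by its lower bound `c`; form-Cauchy sequences thus
  -- converge in `ℓ²`, and the limit is identified coordinate by coordinate.
  let J (v : T.domain) : lp (fun _ : ι => 𝕜) 2 := ⟨w v, hmem v⟩
  have hJnorm (y : lp (fun _ : ι => 𝕜) 2) : HasSum (fun k => ‖y k‖ ^ 2) (‖y‖ ^ 2) := by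
    simpa using lp.hasSum_norm (by simp) y
  have hJ (v : T.domain) : ‖J v‖ ^ 2 = opForm T v - c * ‖(v : E)‖ ^ 2 :=
    (hJnorm (J v)).unique (hsum v)
  have hJsub (v v' : T.domain) : J v - J v' = J (v - v') := by
    ext k
    change w v k - w v' k = w (v - v' : T.domain) k
    simp [w, inner_sub_right, mul_sub]
  have hcauchy : CauchySeq fun n => J (x n) := by
    rw [cauchySeq_iff_tendsto_dist_atTop_0]
    have h1 : Tendsto (fun p : ℕ × ℕ => (x p.1 : E) - x p.2) atTop (𝓝 0) := by
      have := (hxu.comp (tendsto_fst.mono_left prod_atTop_atTop_eq.ge)).sub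
        (hxu.comp (tendsto_snd.mono_left prod_atTop_atTop_eq.ge))
      simpa only [sub_self, Function.comp_def] using this
    have h2 : Tendsto (fun p : ℕ × ℕ => ‖J (x p.1) - J (x p.2)‖ ^ 2) atTop (𝓝 0) := by
      have := hxC.sub ((h1.norm.pow 2).const_mul c)
      simpa [hJsub, hJ] using this
    have h3 := h2.sqrt
    simpa [dist_eq_norm] using h3
  obtain ⟨y, hy⟩ := cauchySeq_tendsto_of_complete hcauchy
  have hyk (k : ι) : y k = w u k := by
    have h1 : Tendsto (fun n => J (x n) k) atTop (𝓝 (y k)) := by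
      rw [tendsto_iff_norm_sub_tendsto_zero] at hy ⊢
      refine squeeze_zero (fun _ => norm_nonneg _) (fun n => ?_) hy
      exact lp.norm_apply_le_norm (by simp) (J (x n) - y) k
    have h2 : Tendsto (fun n => J (x n) k) atTop (𝓝 (w u k)) :=
      ((tendsto_const_nhds (x := φ k)).inner hxu).const_mul _
    exact tendsto_nhds_unique h1 h2
  have hval : ‖y‖ ^ 2 = r - c * ‖u‖ ^ 2 := by
    refine tendsto_nhds_unique (hy.norm.pow 2) ?_
    simp only [hJ]
    exact hxr.sub ((hxu.norm.pow 2).const_mul c)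
  have h := hJnorm y
  simp only [hval, hyk, hw] at h
  simpa using h.add ((φ.hasSum_norm_inner_sq u).mul_left c)

theorem hasFormValue_opForm (T : E →ₗ.[𝕜] E) (u : T.domain) : HasFormValue T u (opForm T u) :=
  ⟨fun _ => u, ⟨tendsto_const_nhds, by simp [opForm]⟩, tendsto_const_nhds⟩

/-- Constant sequences reduce the operator-domain alternative to the form-domain one. -/
theorem HasCommonDomain.hasFormValue {Ω : Type*} {H : Ω → E →ₗ.[𝕜] E} {D : Set E}
    {f : E → Ω → ℝ} (h : HasCommonDomain H D f) {u : E} (hu : u ∈ D) (ω : Ω) :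
    HasFormValue (H ω) u (f u ω) := by
  rcases h with h | h
  · obtain ⟨hdom, hf⟩ := h ω
    rw [← hdom] at hu
    rw [hf ⟨u, hu⟩]
    exact hasFormValue_opForm (H ω) ⟨u, hu⟩
  · exact (h ω).2 u hu

theorem HasCommonDomain.domain_subset {Ω : Type*} {H : Ω → E →ₗ.[𝕜] E} {D : Set E}
    {f : E → Ω → ℝ} (h : HasCommonDomain H D f) (ω : Ω) : ((H ω).domain : Set E) ⊆ D := by
  rcases h with h | h
  · exact (h ω).1.le
  · rw [← (h ω).1]
    intro u hu
    obtain ⟨x, hx, -⟩ := hasFormValue_opForm (H ω) ⟨u, hu⟩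
    exact ⟨x, hx⟩

/-- There is a subspace of dimension `d` in `D` on which the form `g` is smaller than `M`. -/
def SmallOnSubspace (𝕜 : Type*) {E : Type*} [RCLike 𝕜] [NormedAddCommGroup E]
    [InnerProductSpace 𝕜 E] (D : Set E) (g : E → ℝ) (d : ℕ) (M : ℝ) : Prop :=
  ∃ V : Submodule 𝕜 E, Module.finrank 𝕜 V = d ∧
    ∀ u ∈ V, u ≠ 0 → u ∈ D ∧ g u < M * ‖u‖ ^ 2

/-- The variational principle for the eigenvalues. -/
theorem eigenvalue_lt_iff {T : E →ₗ.[𝕜] E} (hT : T.IsFormalAdjoint T) (hbdd : BoundedBelow T)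
    {N : ℕ∞} {lam : {n : ℕ // (n : ℕ∞) < N} → ℝ} (hlam : IsEigenvalueSequence T lam)
    {D : Set E} {g : E → ℝ} (hD : (T.domain : Set E) ⊆ D) (hg : ∀ u ∈ D, HasFormValue T u (g u))
    (n : {n : ℕ // (n : ℕ∞) < N}) (M : ℝ) :
    lam n < M ↔ SmallOnSubspace 𝕜 D g (n + 1) M := by
  obtain ⟨hmono, φ, hφ⟩ := hlam
  have hlt (i : ℕ) (hi : i ≤ n) : (i : ℕ∞) < N := lt_of_le_of_lt (by exact_mod_cast hi) n.2
  constructor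
  · intro hn
    let e : Fin (n + 1) → {n : ℕ // (n : ℕ∞) < N} := fun i => ⟨i, hlt i (by omega)⟩
    have he : Function.Injective e := fun i j h => Fin.ext (congrArg Subtype.val h)
    have hon := φ.orthonormal.comp e he
    refine ⟨Submodule.span 𝕜 (Set.range (φ ∘ e)), ?_, fun u hu hu0 => ?_⟩
    · rw [finrank_span_eq_card hon.linearIndependent, Fintype.card_fin]
    · have hudom : u ∈ T.domain := by
        refine (Submodule.span_le.2 ?_ : Submodule.span 𝕜 (Set.range (φ ∘ e)) ≤ T.domain) hu
        rintro _ ⟨i, rfl⟩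
        exact (hφ (e i)).1
      refine ⟨hD hudom, ?_⟩
      have hzero (k : {n : ℕ // (n : ℕ∞) < N}) (hk : ¬ k ≤ n) : inner 𝕜 (φ k) u = 0 := by
        refine (Submodule.span_le.2 ?_ :
          Submodule.span 𝕜 (Set.range (φ ∘ e)) ≤ LinearMap.ker (innerₛₗ 𝕜 (φ k))) hu
        rintro _ ⟨i, rfl⟩
        refine φ.orthonormal.2 ?_
        rintro rfl
        exact hk (Subtype.coe_le_coe.1 (Nat.lt_succ_iff.1 i.2))
      have h1 := (hg u (hD hudom)).hasSum hT hbdd hφ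
      have h2 := (φ.hasSum_norm_inner_sq u).mul_left (lam n)
      have h3 : g u ≤ lam n * ‖u‖ ^ 2 := by
        refine hasSum_le (fun k => ?_) h1 h2
        by_cases hk : k ≤ n
        · exact mul_le_mul_of_nonneg_right (hmono hk) (by positivity)
        · simp [hzero k hk]
      have : 0 < ‖u‖ ^ 2 := by positivity
      nlinarith
  · rintro ⟨V, hV, hsmall⟩
    by_contra! hn
    -- These are `n` linear conditions on a space of dimension `n + 1`: some nonzero vector only
    -- involves eigenvalues from `lam n` on.
    let L : V →ₗ[𝕜] (Fin n → 𝕜) :=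
      (LinearMap.pi fun i : Fin n => innerₛₗ 𝕜 (φ ⟨i, hlt i i.2.le⟩)).comp V.subtype
    have : FiniteDimensional 𝕜 V := Module.finite_of_finrank_pos (by omega)
    have hker : LinearMap.ker L ≠ ⊥ := LinearMap.ker_ne_bot_of_finrank_lt (by simp [hV])
    obtain ⟨u, hu, hu0⟩ := Submodule.exists_mem_ne_zero_of_ne_bot hker
    have hu0' : (u : E) ≠ 0 := by simpa using hu0
    obtain ⟨huD, hlt'⟩ := hsmall u u.2 hu0'
    have h1 := (hg u huD).hasSum hT hbdd hφ
    have h2 := (φ.hasSum_norm_inner_sq (u : E)).mul_left M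
    refine hlt'.not_ge (hasSum_le (fun k => ?_) h2 h1)
    by_cases hk : n ≤ k
    · exact mul_le_mul_of_nonneg_right (hn.trans (hmono hk)) (by positivity)
    · have h0 : inner 𝕜 (φ k) (u : E) = 0 := by
        have hk' : (k : ℕ) < n := by simpa using hk
        exact congrFun (LinearMap.mem_ker.1 hu) ⟨k, hk'⟩
      simp [h0]

/-- The trace of the spectral projection onto `S` is the number of eigenvalues in `S`. -/
theorem posTrace_spectralProj [CompleteSpace E] {T : E →ₗ.[𝕜] E} (hT : T.IsFormalAdjoint T)
    {lam : ι → ℝ} {φ : HilbertBasis ι 𝕜 E}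
    (hφ : ∀ k, ∃ h : φ k ∈ T.domain, T ⟨φ k, h⟩ = (lam k : 𝕜) • φ k) (S : Set ℝ) :
    posTrace (spectralProj T S) = ∑' k, (lam ⁻¹' S).indicator 1 k := by
  set A : Set E := {u : E | ∃ μ ∈ S, ∃ h : u ∈ T.domain, T ⟨u, h⟩ = (μ : 𝕜) • u} with hA
  set M : Submodule 𝕜 E := (Submodule.span 𝕜 A).topologicalClosure with hM
  have hproj : spectralProj T S = M.starProjection := rfl
  have hAM : A ⊆ M := Submodule.subset_span.trans (Submodule.le_topologicalClosure _)
  have hmem (k : ι) (hk : lam k ∈ S) : M.starProjection (φ k) = φ k :=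
    Submodule.starProjection_eq_self_iff.2 (hAM ⟨lam k, hk, hφ k⟩)
  have hnot (k : ι) (hk : lam k ∉ S) : M.starProjection (φ k) = 0 := by
    rw [Submodule.starProjection_apply_eq_zero_iff, hM, Submodule.orthogonal_closure,
      Submodule.mem_orthogonal]
    intro u hu
    suffices h : Submodule.span 𝕜 A ≤ LinearMap.ker (innerₛₗ 𝕜 (φ k)) from
      inner_eq_zero_symm.1 (h hu)
    rw [Submodule.span_le]
    -- Eigenvectors of a symmetric operator with different eigenvalues are orthogonal.
    rintro v ⟨μ, hμ, hv, hTv⟩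
    have h1 := inner_eigenvector_apply hT (hφ k) ⟨v, hv⟩
    rw [hTv, inner_smul_right] at h1
    have h2 : ((μ : 𝕜) - lam k) * inner 𝕜 (φ k) v = 0 := by rw [sub_mul, h1, sub_self]
    refine (mul_eq_zero.1 h2).resolve_left fun h3 => hk ?_
    have : μ = lam k := by exact_mod_cast sub_eq_zero.1 h3
    exact this ▸ hμ
  obtain ⟨e, he⟩ := (exists_hilbertBasis 𝕜 E).choose_spec
  have hterm (x : E) : ENNReal.ofReal (RCLike.re (inner 𝕜 (M.starProjection x) x)) =
      ∑' k, ENNReal.ofReal (‖(inner 𝕜 x (M.starProjection (φ k)) : 𝕜)‖ ^ 2) := by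
    have h1 : RCLike.re (inner 𝕜 (M.starProjection x) x) = ‖M.starProjection x‖ ^ 2 := by
      rw [← inner_self_eq_norm_sq (𝕜 := 𝕜), ← Submodule.inner_starProjection_left_eq_right,
        Submodule.starProjection_eq_self_iff.2 (Submodule.starProjection_apply_mem M x)]
    rw [h1, ← φ.tsum_ofReal_norm_inner_sq]
    congr 1
    funext k
    rw [← Submodule.inner_starProjection_left_eq_right, norm_inner_symm]
  calc posTrace (spectralProj T S)
      = ∑' i, ∑' k, ENNReal.ofReal (‖(inner 𝕜 (e i) (M.starProjection (φ k)) : 𝕜)‖ ^ 2) := by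
        simp only [posTrace, hproj, hterm, he]
    _ = ∑' k, ENNReal.ofReal (‖M.starProjection (φ k)‖ ^ 2) := by
        rw [ENNReal.tsum_comm]
        simp only [e.tsum_ofReal_norm_inner_sq]
    _ = _ := by
        congr 1
        funext k
        by_cases hk : lam k ∈ S
        · rw [hmem k hk, φ.orthonormal.norm_eq_one, indicator_of_mem (by exact hk)]
          simp
        · rw [hnot k hk, indicator_of_notMem (by exact hk)]
          simp

end Eigenbasis

/-! ### Monotonicity and scaling in the couplings -/

section Variational

variable {𝕜 E ι : Type*} [RCLike 𝕜] [NormedAddCommGroup E] [InnerProductSpace 𝕜 E]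

/-- The coupling configurations `x` that lie below some admissible configuration `y`, for which the
form with weights `(q - σ * y α) ^ ζ` is smaller than `M` on a subspace of dimension `d`. -/
def smallWeightSet (𝕜 : Type*) {E ι : Type*} [RCLike 𝕜] [NormedAddCommGroup E]
    [InnerProductSpace 𝕜 E] (D : Set E) (a : E → ℝ) (b : ι → E → ℝ) (F : Finset ι) (q σ ζ : ℝ)
    (d : ℕ) (M : ℝ) : Set (ι → ℝ) :=
  {x | ∃ y : ι → ℝ, (∀ α ∈ F, x α ≤ y α ∧ σ * y α < q) ∧
    SmallOnSubspace 𝕜 D (fun u => a u - ∑ α ∈ F, (q - σ * y α) ^ ζ * b α u) d M}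

variable {D : Set E} {a : E → ℝ} {b : ι → E → ℝ} {F : Finset ι} {q σ ζ : ℝ} {d : ℕ} {M : ℝ}

theorem isLowerOn_smallWeightSet : IsLowerOn F (smallWeightSet 𝕜 D a b F q σ ζ d M) := by
  rintro x ⟨y, hxy, hy⟩ z hz
  exact ⟨y, fun α hα => ⟨(hz α hα).trans (hxy α hα).1, (hxy α hα).2⟩, hy⟩

theorem SmallOnSubspace.mono {g g' : E → ℝ} (h : SmallOnSubspace 𝕜 D g d M)
    (hg : ∀ u ∈ D, g' u ≤ g u) : SmallOnSubspace 𝕜 D g' d M := by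
  obtain ⟨V, hV, h⟩ := h
  exact ⟨V, hV, fun u hu hu0 => ⟨(h u hu hu0).1, (hg u (h u hu hu0).1).trans_lt (h u hu hu0).2⟩⟩

theorem SmallOnSubspace.scale {g : E → ℝ} (h : SmallOnSubspace 𝕜 D g d M) {s : ℝ} (hs : 0 < s) :
    SmallOnSubspace 𝕜 D (fun u => s * g u) d (s * M) := by
  obtain ⟨V, hV, h⟩ := h
  refine ⟨V, hV, fun u hu hu0 => ⟨(h u hu hu0).1, ?_⟩⟩
  rw [mul_assoc]
  exact mul_lt_mul_of_pos_left (h u hu hu0).2 hs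

/-- The sign of `ζ` is `σ`, so that `x ↦ (q - σ * x) ^ ζ` is decreasing. -/
def IsSignOf (σ ζ : ℝ) : Prop := (0 < ζ ∧ σ = 1) ∨ (ζ < 0 ∧ σ = -1)

theorem IsSignOf.mul_self (h : IsSignOf σ ζ) : σ * σ = 1 := by
  rcases h with ⟨-, rfl⟩ | ⟨-, rfl⟩ <;> norm_num

theorem IsSignOf.rpow_anti (h : IsSignOf σ ζ) {x y : ℝ} (hxy : x ≤ y) (hx : σ * x < q)
    (hy : σ * y < q) : (q - σ * y) ^ ζ ≤ (q - σ * x) ^ ζ := by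
  rcases h with ⟨h, rfl⟩ | ⟨h, rfl⟩
  · exact Real.rpow_le_rpow (by linarith) (by linarith) h.le
  · exact Real.rpow_le_rpow_of_nonpos (by linarith) (by linarith) h.le

/-- With `r = s ^ (1 / ζ)` the displacement is `(q - t) |r - 1|`, where `q - t ≤ q - m`. For `ζ < 0`
one has `r ≤ 1`, and `1 - r ≤ r⁻¹ - 1`. -/
theorem IsSignOf.shift_le (h : IsSignOf σ ζ) {s t m : ℝ} (hs : 1 ≤ s) (ht : t < q) (hm : m ≤ t) :
    σ * t - (q - m) * (s ^ (1 / |ζ|) - 1) ≤ σ * (q - s ^ (1 / ζ) * (q - t)) := by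
  rcases h with ⟨h, rfl⟩ | ⟨h, rfl⟩
  · rw [abs_of_pos h]
    have : 1 ≤ s ^ (1 / ζ) := Real.one_le_rpow hs (by positivity)
    nlinarith
  · rw [abs_of_neg h, one_div_neg_eq_neg_one_div, Real.rpow_neg (by linarith)]
    set r := s ^ (1 / ζ)
    have hr : 0 < r := Real.rpow_pos_of_pos (by linarith) _
    have hr1 : r ≤ 1 := Real.rpow_le_one_of_one_le_of_nonpos hs (one_div_nonpos.2 h.le)
    have h1 : 1 - r ≤ r⁻¹ - 1 := by
      have : (r⁻¹ - 1) - (1 - r) = r⁻¹ * (1 - r) ^ 2 := by field_simp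
      have : 0 ≤ r⁻¹ * (1 - r) ^ 2 := by positivity
      linarith
    nlinarith [mul_le_mul (by linarith : q - t ≤ q - m) h1 (by linarith) (by linarith)]

/-- Moving up to `y` lowers the weights and so raises the form; smallness at `y` therefore passes
down to `ω`. -/
theorem scaledPoint_mem_smallWeightSet_iff {qm qp : ℝ} (hσ : IsSignOf σ ζ) (hq : qp < q)
    (hb : ∀ α ∈ F, ∀ u ∈ D, 0 ≤ b α u) (ω : ι → Icc qm qp) :
    scaledPoint σ ω ∈ smallWeightSet 𝕜 D a b F q σ ζ d M ↔
      SmallOnSubspace 𝕜 D (fun u => a u - ∑ α ∈ F, (q - (ω α : ℝ)) ^ ζ * b α u) d M := by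
  have hσσ (t : ℝ) : σ * (σ * t) = t := by rw [← mul_assoc, hσ.mul_self, one_mul]
  have hlt (α : ι) : σ * scaledPoint σ ω α < q := by
    rw [scaledPoint, hσσ]
    exact (ω α).2.2.trans_lt hq
  constructor
  · rintro ⟨y, hy, h⟩
    refine h.mono fun u hu => ?_
    refine sub_le_sub_left (Finset.sum_le_sum fun α hα => ?_) _
    refine mul_le_mul_of_nonneg_right ?_ (hb α hα u hu)
    have := hσ.rpow_anti (hy α hα).1 (hlt α) (hy α hα).2
    rwa [scaledPoint, hσσ] at this
  · intro h
    refine ⟨scaledPoint σ ω, fun α _ => ⟨le_rfl, hlt α⟩, ?_⟩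
    simpa only [scaledPoint, hσσ] using h

/-- Scaling all weights by `s ≥ 1` at the cost of a shift of the coordinates. -/
theorem scaledPoint_sub_mem_smallWeightSet {qm qp : ℝ} (hσ : IsSignOf σ ζ) (hq : qp < q)
    (ha : ∀ u ∈ D, 0 ≤ a u) {s : ℝ} (hs : 1 ≤ s) {ω : ι → Icc qm qp}
    (h : SmallOnSubspace 𝕜 D (fun u => a u - ∑ α ∈ F, (q - (ω α : ℝ)) ^ ζ * b α u) d M) :
    scaledPoint σ ω - constOn F ((q - qm) * (s ^ (1 / |ζ|) - 1)) ∈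
      smallWeightSet 𝕜 D a b F q σ ζ d (s * M) := by
  have hs0 : 0 < s := by linarith
  have hζ : ζ ≠ 0 := by rcases hσ with ⟨h, -⟩ | ⟨h, -⟩ <;> [exact h.ne'; exact h.ne]
  have hr : 0 < s ^ (1 / ζ) := Real.rpow_pos_of_pos hs0 _
  have hσσ (t : ℝ) : σ * (σ * t) = t := by rw [← mul_assoc, hσ.mul_self, one_mul]
  have hpos (α : ι) : 0 < q - (ω α : ℝ) := by linarith [(ω α).2.2]
  -- The witness solves `(q - σ * y α) ^ ζ = s * (q - ω α) ^ ζ`.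
  refine ⟨fun α => σ * (q - s ^ (1 / ζ) * (q - ω α)), fun α hα => ⟨?_, ?_⟩, ?_⟩
  · rw [Pi.sub_apply, constOn_apply_of_mem hα]
    exact hσ.shift_le hs (by linarith [hpos α]) (ω α).2.1
  · rw [hσσ]
    linarith [mul_pos hr (hpos α)]
  · refine (h.scale hs0).mono fun u hu => ?_
    have hterm (α : ι) : (q - σ * (σ * (q - s ^ (1 / ζ) * (q - ω α)))) ^ ζ * b α u =
        s * ((q - (ω α : ℝ)) ^ ζ * b α u) := by
      rw [hσσ, sub_sub_cancel, Real.mul_rpow hr.le (hpos α).le, ← Real.rpow_mul hs0.le,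
        one_div_mul_cancel hζ, Real.rpow_one, mul_assoc]
    simp only [hterm, ← Finset.mul_sum]
    -- Here `a u ≤ s * a u`, from `a u ≥ 0` and `s ≥ 1`.
    nlinarith [ha u hu]

end Variational

/-! ### The estimate for one eigenvalue -/

section EigenvalueCount

variable {𝕜 E ι : Type*} [RCLike 𝕜] [NormedAddCommGroup E] [InnerProductSpace 𝕜 E]
  [CompleteSpace E] [Countable ι] {qm qp : ℝ} (P : Measure (ι → Icc qm qp))
  [IsProbabilityMeasure P]

/-- The Wegner estimate for a single eigenvalue. -/
theorem nullMeasurableSet_and_measure_eigenvalue_mem_le {F : Finset ι}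
    (hP : Tendsto (fun ε : ℝ => modulusF P F ε) (𝓝[>] 0) (𝓝 0))
    {H : (ι → Icc qm qp) → E →ₗ.[𝕜] E}
    (hsa : ∀ ω, IsSelfAdjoint (H ω)) (hbdd : ∀ ω, BoundedBelow (H ω))
    {N : ℕ∞} {lam : (ι → Icc qm qp) → {n : ℕ // (n : ℕ∞) < N} → ℝ}
    (hlam : ∀ ω, IsEigenvalueSequence (H ω) (lam ω))
    {E₁ E₂ : ℝ} (hE : E₁ < E₂) (hE₂ : E₂ < 0)
    {D : Set E} {f : E → (ι → Icc qm qp) → ℝ} (hD : HasCommonDomain H D f)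
    {q ζ : ℝ} (hq : qp < q) (hζ : ζ ≠ 0) {a : E → ℝ} {b : ι → E → ℝ}
    (ha : ∀ u ∈ D, 0 ≤ a u) (hb : ∀ α ∈ F, ∀ u ∈ D, 0 ≤ b α u)
    (hf : ∀ u ∈ D, ∀ ω, f u ω = a u - ∑ α ∈ F, (q - (ω α : ℝ)) ^ ζ * b α u)
    (n : {n : ℕ // (n : ℕ∞) < N}) :
    NullMeasurableSet {ω | lam ω n ∈ Ioo E₁ E₂} P ∧
      P {ω | lam ω n ∈ Ioo E₁ E₂} ≤ 2 * F.card *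
        modulusF P F ((q - qm) * ((1 + (E₂ - E₁) / |E₂|) ^ (1 / |ζ|) - 1)) := by
  obtain ⟨σ, hσ⟩ : ∃ σ, IsSignOf σ ζ := by
    rcases hζ.lt_or_gt with h | h
    exacts [⟨-1, Or.inr ⟨h, rfl⟩⟩, ⟨1, Or.inl ⟨h, rfl⟩⟩]
  have hσ' : σ = 1 ∨ σ = -1 := by
    rcases hσ with ⟨-, h⟩ | ⟨-, h⟩ <;> simp [h]
  have hsmall (ω : ι → Icc qm qp) (M : ℝ) : lam ω n < M ↔
      SmallOnSubspace 𝕜 D (fun u => a u - ∑ α ∈ F, (q - (ω α : ℝ)) ^ ζ * b α u) (n + 1) M :=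
    eigenvalue_lt_iff (LinearPMap.isFormalAdjoint_self (hsa ω)) (hbdd ω) (hlam ω)
      (hD.domain_subset ω) (fun u hu => hf u hu ω ▸ hD.hasFormValue hu ω) n M
  let W (M : ℝ) : Set (ι → ℝ) := smallWeightSet 𝕜 D a b F q σ ζ (n + 1) M
  have hW (M : ℝ) : IsLowerOn F (W M) := isLowerOn_smallWeightSet
  have hiff (ω : ι → Icc qm qp) (M : ℝ) : lam ω n < M ↔ scaledPoint σ ω ∈ W M := by
    rw [hsmall, ← scaledPoint_mem_smallWeightSet_iff hσ hq hb]
  have hnull (M : ℝ) : NullMeasurableSet {ω | lam ω n < M} P := by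
    simp only [hiff]
    exact nullMeasurableSet_of_isLowerOn P hσ' hP (hW M)
  set s : ℝ := 1 + (E₂ - E₁) / |E₂| with hs_def
  have hs1 : 1 < s := by
    have : 0 < (E₂ - E₁) / |E₂| := div_pos (by linarith) (abs_pos.2 hE₂.ne)
    linarith
  have hsE : s * E₂ = E₁ := by
    rw [hs_def, abs_of_neg hE₂, div_neg, sub_div, div_self hE₂.ne]
    field_simp [hE₂.ne]
    ring
  constructor
  -- Only strict sublevel sets are known to be null measurable, so `lam ω n ≤ E₁` is written as a
  -- countable intersection.
  · have heq : {ω | lam ω n ∈ Ioo E₁ E₂} =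
        {ω | lam ω n < E₂} \ ⋂ k : ℕ, {ω | lam ω n < E₁ + 1 / ((k : ℝ) + 1)} := by
      ext ω
      have : lam ω n ≤ E₁ ↔ ∀ k : ℕ, lam ω n < E₁ + 1 / ((k : ℝ) + 1) := by
        constructor
        · intro h k
          have : (0 : ℝ) < 1 / ((k : ℝ) + 1) := by positivity
          linarith
        · intro h
          by_contra! hlt
          obtain ⟨k, hk⟩ := exists_nat_one_div_lt (sub_pos.2 hlt)
          linarith [h k]
      simp only [mem_Ioo, Set.mem_sdiff, mem_iInter, mem_ofPred_eq, ← this, not_le]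
      exact and_comm
    rw [heq]
    exact (hnull _).diff (NullMeasurableSet.iInter fun k => hnull _)
  · refine le_trans (measure_mono fun ω hω => ?_) (measure_shift_le P hσ' hP (hW E₁) ?_)
    · refine ⟨fun h => ((hiff ω E₁).2 h).not_gt hω.1, ?_⟩
      have := scaledPoint_sub_mem_smallWeightSet hσ hq ha hs1.le ((hsmall ω E₂).1 hω.2)
      rwa [hsE] at this
    · rintro ⟨α, -⟩
      obtain ⟨ω⟩ := nonempty_of_isProbabilityMeasure P
      have h1 : 0 < q - qm := by linarith [(ω α).2.1, (ω α).2.2]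
      have h2 : 1 < s ^ (1 / |ζ|) := Real.one_lt_rpow hs1 (by positivity)
      exact mul_pos h1 (by linarith)

end EigenvalueCount

/-! ### Summation over the eigenvalues -/

theorem theorem2p3
    {𝕜 E ι : Type*} [RCLike 𝕜] [NormedAddCommGroup E] [InnerProductSpace 𝕜 E] [CompleteSpace E]
    [TopologicalSpace.SeparableSpace E] [Countable ι]
    -- the probability space `Ω = [qm, qp] ^ ι`, and the finite set of relevant coordinates
    {qm qp : ℝ} (P : Measure (ι → Icc qm qp)) [IsProbabilityMeasure P] (F : Finset ι)
    (hP : Tendsto (fun ε : ℝ => modulusF P F ε) (𝓝[>] 0) (𝓝 0))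
    -- the operators `H ω` and their eigenvalues
    (H : (ι → Icc qm qp) → E →ₗ.[𝕜] E)
    (hsa : ∀ ω, IsSelfAdjoint (H ω)) (hbdd : ∀ ω, BoundedBelow (H ω))
    {N : ℕ∞} (lam : (ι → Icc qm qp) → {n : ℕ // (n : ℕ∞) < N} → ℝ)
    (hlam : ∀ ω, IsEigenvalueSequence (H ω) (lam ω))
    -- at most the first `K` eigenvalues can lie in `I = (E₁, E₂)`; `lam ω n` is the `(n+1)`-st
    {E₁ E₂ : ℝ} (hE : E₁ < E₂) (hE₂ : E₂ < 0) {K : ℝ} (hK : 0 ≤ K)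
    (hlamK : ∀ ω (n : {n : ℕ // (n : ℕ∞) < N}), K < ((n : ℕ) : ℝ) + 1 →
      lam ω n ∉ Ioo E₁ E₂)
    -- the common domain and the quadratic forms
    (D : Set E) (f : E → (ι → Icc qm qp) → ℝ) (hD : HasCommonDomain H D f)
    {q ζ : ℝ} (hq : qp < q) (hζ : ζ ≠ 0) (a : E → ℝ) (b : ι → E → ℝ)
    (ha : ∀ u ∈ D, 0 ≤ a u) (hb : ∀ α ∈ F, ∀ u ∈ D, 0 ≤ b α u)
    (hf : ∀ u ∈ D, ∀ ω, f u ω = a u - ∑ α ∈ F, (q - (ω α : ℝ)) ^ ζ * b α u) :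
    -- measurability with respect to the completion of the product `σ`-algebra
    NullMeasurable (fun ω => posTrace (spectralProj (H ω) (Ioo E₁ E₂))) P ∧
    ∫⁻ ω : NullMeasurableSpace (ι → Icc qm qp) P,
        posTrace (spectralProj (H ω) (Ioo E₁ E₂)) ∂P.completion
      ≤ 2 * ENNReal.ofReal K * (F.card : ℝ≥0∞) *
        modulusF P F ((q - qm) * ((1 + (E₂ - E₁) / |E₂|) ^ (1 / |ζ|) - 1)) ∧
    (ζ = 1 ∨ ζ = -1 →
      ∫⁻ ω : NullMeasurableSpace (ι → Icc qm qp) P,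
          posTrace (spectralProj (H ω) (Ioo E₁ E₂)) ∂P.completion
        ≤ 2 * ENNReal.ofReal K * (F.card : ℝ≥0∞) *
          modulusF P F ((q - qm) / |E₂| * (E₂ - E₁))) := by
  have htrace (ω : ι → Icc qm qp) : posTrace (spectralProj (H ω) (Ioo E₁ E₂)) =
      ∑' n, {ω | lam ω n ∈ Ioo E₁ E₂}.indicator 1 ω := by
    obtain ⟨-, φ, hφ⟩ := hlam ω
    exact posTrace_spectralProj (LinearPMap.isFormalAdjoint_self (hsa ω)) hφ _
  have hn := nullMeasurableSet_and_measure_eigenvalue_mem_le P hP hsa hbdd hlam hE hE₂ hD hq hζ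
    ha hb hf
  have hmeas (n : {n : ℕ // (n : ℕ∞) < N}) :
      Measurable[(inferInstance : MeasurableSpace (NullMeasurableSpace (ι → Icc qm qp) P))]
        ({ω | lam ω n ∈ Ioo E₁ E₂}.indicator (1 : (ι → Icc qm qp) → ℝ≥0∞)) :=
    measurable_one.indicator (hn n).1
  set C := (F.card : ℝ≥0∞) *
    modulusF P F ((q - qm) * ((1 + (E₂ - E₁) / |E₂|) ^ (1 / |ζ|) - 1)) with hC
  -- Indices start at `0`, so the eigenvalues not excluded from the interval have `n + 1 ≤ K`, that
  -- is `n < ⌊K⌋₊`.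
  have hfloor (n : ℕ) : n ∈ Finset.range ⌊K⌋₊ ↔ ¬ K < (n : ℝ) + 1 := by
    rw [Finset.mem_range, ← Nat.succ_le_iff, Nat.le_floor_iff hK, not_lt]
    push_cast
    rfl
  have hbound (n : {n : ℕ // (n : ℕ∞) < N}) : P {ω | lam ω n ∈ Ioo E₁ E₂} ≤
      (Finset.range ⌊K⌋₊ : Set ℕ).indicator (fun _ => 2 * C) (n : ℕ) := by
    by_cases h : (n : ℕ) ∈ Finset.range ⌊K⌋₊
    · rw [indicator_of_mem (by exact_mod_cast h), hC, ← mul_assoc]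
      exact (hn n).2
    · have : {ω | lam ω n ∈ Ioo E₁ E₂} = ∅ :=
        eq_empty_of_forall_notMem fun ω => hlamK ω n (not_not.1 fun h' => h ((hfloor _).2 h'))
      rw [this, measure_empty]
      exact zero_le
  have hmain : ∫⁻ ω : NullMeasurableSpace (ι → Icc qm qp) P,
      posTrace (spectralProj (H ω) (Ioo E₁ E₂)) ∂P.completion
      ≤ 2 * ENNReal.ofReal K * (F.card : ℝ≥0∞) *
        modulusF P F ((q - qm) * ((1 + (E₂ - E₁) / |E₂|) ^ (1 / |ζ|) - 1)) := by
    calc ∫⁻ ω : NullMeasurableSpace (ι → Icc qm qp) P,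
          posTrace (spectralProj (H ω) (Ioo E₁ E₂)) ∂P.completion
        = ∫⁻ ω : NullMeasurableSpace (ι → Icc qm qp) P,
            ∑' n, {ω | lam ω n ∈ Ioo E₁ E₂}.indicator 1 ω ∂P.completion :=
          lintegral_congr htrace
      _ = ∑' n, ∫⁻ ω : NullMeasurableSpace (ι → Icc qm qp) P,
            {ω | lam ω n ∈ Ioo E₁ E₂}.indicator 1 ω ∂P.completion :=
          lintegral_tsum fun n => (hmeas n).aemeasurable
      _ = ∑' n, P {ω | lam ω n ∈ Ioo E₁ E₂} := by
          congr 1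
          funext n
          exact (lintegral_indicator_one (hn n).1).trans (Measure.completion_apply P _)
      _ ≤ ∑' n : {n : ℕ // (n : ℕ∞) < N},
            (Finset.range ⌊K⌋₊ : Set ℕ).indicator (fun _ => 2 * C) (n : ℕ) :=
          ENNReal.tsum_le_tsum hbound
      _ ≤ ∑' n : ℕ, (Finset.range ⌊K⌋₊ : Set ℕ).indicator (fun _ => 2 * C) n :=
          ENNReal.tsum_comp_le_tsum_of_injective Subtype.val_injective _
      _ = ⌊K⌋₊ * (2 * C) := by
          rw [← sum_eq_tsum_indicator, Finset.sum_const, Finset.card_range, nsmul_eq_mul]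
      _ ≤ ENNReal.ofReal K * (2 * C) := by
          gcongr
          rw [← ENNReal.ofReal_natCast]
          exact ENNReal.ofReal_le_ofReal (Nat.floor_le hK)
      _ = _ := by rw [hC]; ring
  refine ⟨?_, hmain, fun h1 => ?_⟩
  · have : Measurable[(inferInstance : MeasurableSpace (NullMeasurableSpace (ι → Icc qm qp) P))]
        fun ω : ι → Icc qm qp => posTrace (spectralProj (H ω) (Ioo E₁ E₂)) := by
      rw [funext htrace]
      exact Measurable.tsum hmeas
    exact this
  · have habs : |ζ| = 1 := by rcases h1 with rfl | rfl <;> simp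
    have harg : (q - qm) * ((1 + (E₂ - E₁) / |E₂|) ^ (1 / |ζ|) - 1) =
        (q - qm) / |E₂| * (E₂ - E₁) := by
      rw [habs, div_one, Real.rpow_one]
      ring
    rwa [harg] at hmain
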